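/- Let $(\Omega,\Sigma,\mu)$ be a $\sigma$-finite measure space and let $X$ be a separable real Banach function space (Köthe function space) on $(\Omega,\mu)$: a Banach space of $\mu$-a.e. equivalence classes of real measurable functions, integrable on every set of finite measure, such that (i) if $f$ is measurable, $h\in X$ and $|f|\le|h|$ a.e., then $f\in X$ and $\|f\|\le\|h\|$, and (ii) $\chi_S\in X$ for every measurable set $S$ with $\mu(S)<\infty$. Assume that $X$ is strictly monotone, i.e. $\|f\|<\|h\|$ whenever $f,h\in X$, $0\le f\le h$ a.e. and $f\ne h$. Assume moreover that one of the following holds: (a) $X$ is one-$p$-convex for some $2<p<\infty$, i.e. $\big\|(\sum_{i=1}^n|x_i|^p)^{1/p}\big\|\le(\sum_{i=1}^n\|x_i\|^p)^{1/p}$ for all finite families $x_1,\dots,x_n\in X$; or (b) $X$ is one-$q$-concave for some $1<q<2$, i.e. $\big\|(\sum_{i=1}^n|x_i|^q)^{1/q}\big\|\ge(\sum_{i=1}^n\|x_i\|^q)^{1/q}$ for all finite families $x_1,\dots,x_n\in X$, and, for every atom $A$ of $\mu$, $X$ is smooth at $\chi_A$, i.e. there is exactly one $\varphi\in X^*$ with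 $\|\varphi\|=1$ and $\varphi(\chi_A)=\|\chi_A\|$. Let $0\neq g\in X^*$ be such that $\ker g$ is 1-complemented in $X$, i.e. $\ker g$ is the range of a linear projection $P:X\to X$ with $\|P\|\le 1$. Then $g=\alpha\chi_A+\beta\chi_B$ for some $\alpha,\beta\in\mathbb R$ and some (not necessarily distinct) atoms $A,B$ of $\mu$, i.e. $g(f)=\int_\Omega(\alpha\chi_A+\beta\chi_B)\,f\,d\mu$ for all $f\in X$. -/

import Mathlib

open MeasureTheory Filter
open scoped ENNReal

/-- A real (normed) Köthe function space on `(Ω, μ)`: a linear space of `μ`-a.e. classes of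
real measurable functions, integrable over every set of finite measure, which is a solid
(order) ideal with a monotone norm and contains the characteristic functions of all measurable
sets of finite measure. Norm completeness is expressed by `CompleteSpace X.carrier`. -/
structure FunctionSpace {Ω : Type*} [MeasurableSpace Ω] (μ : Measure Ω) where
  /-- the classes of functions that belong to the space -/
  carrier : Submodule ℝ (Ω →ₘ[μ] ℝ)
  /-- the norm of the space -/
  normFun : carrier → ℝ
  normFun_nonneg : ∀ f, 0 ≤ normFun f
  normFun_eq_zero : ∀ f, normFun f = 0 ↔ f = 0
  normFun_smul : ∀ (c : ℝ) (f), normFun (c • f) = |c| * normFun f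
  normFun_add_le : ∀ f g, normFun (f + g) ≤ normFun f + normFun g
  integrableOn : ∀ f ∈ carrier, ∀ s : Set Ω, MeasurableSet s → μ s < ∞ → IntegrableOn f s μ
  solid : ∀ f g : Ω →ₘ[μ] ℝ, |f| ≤ |g| → g ∈ carrier → f ∈ carrier
  normFun_mono : ∀ f g : carrier, |(f : Ω →ₘ[μ] ℝ)| ≤ |(g : Ω →ₘ[μ] ℝ)| → normFun f ≤ normFun g
  indicator_mem : ∀ s : Set Ω, MeasurableSet s → μ s < ∞ →
    ∀ f : Ω →ₘ[μ] ℝ, f =ᵐ[μ] s.indicator (fun _ => (1 : ℝ)) → f ∈ carrier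

namespace FunctionSpace

variable {Ω : Type*} [MeasurableSpace Ω] {μ : Measure Ω}

instance instNormCarrier (X : FunctionSpace μ) : Norm X.carrier := ⟨X.normFun⟩

theorem core (X : FunctionSpace μ) : NormedSpace.Core ℝ X.carrier where
  norm_nonneg := X.normFun_nonneg
  norm_smul := X.normFun_smul
  norm_triangle := X.normFun_add_le
  norm_eq_zero_iff := X.normFun_eq_zero

noncomputable instance instNormedAddCommGroup (X : FunctionSpace μ) :
    NormedAddCommGroup X.carrier :=
  NormedAddCommGroup.ofCore X.core

noncomputable instance instNormedSpace (X : FunctionSpace μ) : NormedSpace ℝ X.carrier :=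
  NormedSpace.ofCore X.core

/-- Strict monotonicity: `0 ≤ f ≤ g` and `f ≠ g` imply `‖f‖ < ‖g‖`. -/
def StrictlyMonotone (X : FunctionSpace μ) : Prop :=
  ∀ f g : X.carrier, (0 : Ω →ₘ[μ] ℝ) ≤ f → (f : Ω →ₘ[μ] ℝ) ≤ g → f ≠ g → ‖f‖ < ‖g‖

/-- `z` is the class of the function `(∑ i, |x i| ^ p) ^ (1 / p)`. For `1 ≤ p` exactly one
element `z` of the space has this property, see `existsUnique_isPowerSum`. -/
def IsPowerSum {X : FunctionSpace μ} (p : ℝ) {n : ℕ} (x : Fin n → X.carrier) (z : X.carrier) :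
    Prop :=
  (z : Ω →ₘ[μ] ℝ) =ᵐ[μ] fun ω => (∑ i, |(x i : Ω →ₘ[μ] ℝ) ω| ^ p) ^ (1 / p)

/-- One-`p`-convexity: `‖(∑ |x i| ^ p) ^ (1/p)‖ ≤ (∑ ‖x i‖ ^ p) ^ (1/p)` for all finite families. -/
def OneConvex (X : FunctionSpace μ) (p : ℝ) : Prop :=
  ∀ (n : ℕ) (x : Fin n → X.carrier) (z : X.carrier), IsPowerSum p x z →
    ‖z‖ ≤ (∑ i, ‖x i‖ ^ p) ^ (1 / p)

/-- One-`q`-concavity: `‖(∑ |x i| ^ q) ^ (1/q)‖ ≥ (∑ ‖x i‖ ^ q) ^ (1/q)` for all finite families. -/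
def OneConcave (X : FunctionSpace μ) (q : ℝ) : Prop :=
  ∀ (n : ℕ) (x : Fin n → X.carrier) (z : X.carrier), IsPowerSum q x z →
    (∑ i, ‖x i‖ ^ q) ^ (1 / q) ≤ ‖z‖

theorem rpow_sum_le_sum {n : ℕ} (a : Fin n → ℝ) (ha : ∀ i, 0 ≤ a i) {p : ℝ} (hp : 1 ≤ p) :
    (∑ i, a i ^ p) ^ (1 / p) ≤ ∑ i, a i := by
  have hS : 0 ≤ ∑ i, a i := Finset.sum_nonneg fun i _ => ha i
  have hp0 : 0 < p := by linarith
  have key : ∑ i, a i ^ p ≤ (∑ i, a i) ^ p := by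
    have h1 : ∀ i, a i ^ p ≤ a i * (∑ j, a j) ^ (p - 1) := fun i => by
      rcases (ha i).eq_or_lt with h | h
      · rw [← h, Real.zero_rpow hp0.ne']; simp
      · have h2 : a i ^ p = a i * a i ^ (p - 1) := by
          rw [Real.rpow_sub_one h.ne']; field_simp
        rw [h2]
        have h3 : a i ≤ ∑ j, a j :=
          Finset.single_le_sum (fun j _ => ha j) (Finset.mem_univ i)
        exact mul_le_mul_of_nonneg_left (Real.rpow_le_rpow (ha i) h3 (by linarith)) (ha i)
    refine (Finset.sum_le_sum fun i _ => h1 i).trans ?_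
    rw [← Finset.sum_mul]
    rcases hS.eq_or_lt with h | h
    · rw [← h, Real.zero_rpow hp0.ne']; simp
    · rw [Real.rpow_sub_one h.ne']
      exact le_of_eq (by field_simp)
  calc (∑ i, a i ^ p) ^ (1 / p) ≤ ((∑ i, a i) ^ p) ^ (1 / p) :=
        Real.rpow_le_rpow (Finset.sum_nonneg fun i _ => Real.rpow_nonneg (ha i) p) key
          (by positivity)
    _ = ∑ i, a i := by rw [one_div, Real.rpow_rpow_inv hS hp0.ne']

theorem existsUnique_isPowerSum {X : FunctionSpace μ} {p : ℝ} (hp : 1 ≤ p) {n : ℕ}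
    (x : Fin n → X.carrier) : ∃! z : X.carrier, IsPowerSum p x z := by
  have hm : AEStronglyMeasurable
      (fun ω => (∑ i, |(x i : Ω →ₘ[μ] ℝ) ω| ^ p) ^ (1 / p)) μ := by
    apply AEMeasurable.aestronglyMeasurable
    have h := fun i => (x i : Ω →ₘ[μ] ℝ).aestronglyMeasurable.aemeasurable
    fun_prop
  -- the sum of the absolute values dominates the power sum
  have habs : ∀ i, |(x i : Ω →ₘ[μ] ℝ)| ∈ X.carrier := fun i =>
    X.solid _ (x i : Ω →ₘ[μ] ℝ) (by
      rw [← AEEqFun.coeFn_le]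
      filter_upwards [AEEqFun.coeFn_abs |(x i : Ω →ₘ[μ] ℝ)|,
        AEEqFun.coeFn_abs (x i : Ω →ₘ[μ] ℝ)] with ω h1 h2
      rw [h1, h2, abs_abs]) (x i).2
  have hsum : ∀ s : Finset (Fin n),
      (↑(∑ i ∈ s, |(x i : Ω →ₘ[μ] ℝ)|) : Ω → ℝ) =ᵐ[μ]
        fun ω => ∑ i ∈ s, |(x i : Ω →ₘ[μ] ℝ) ω| := fun s => by
    induction s using Finset.induction_on with
    | empty =>
      simp only [Finset.sum_empty]
      exact AEEqFun.coeFn_zero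
    | insert a s has ih =>
      rw [Finset.sum_insert has]
      filter_upwards [ih, AEEqFun.coeFn_abs (x a : Ω →ₘ[μ] ℝ),
        AEEqFun.coeFn_add |(x a : Ω →ₘ[μ] ℝ)| (∑ i ∈ s, |(x i : Ω →ₘ[μ] ℝ)|)] with ω h1 h2 h3
      rw [h3, Pi.add_apply, h1, h2, Finset.sum_insert has]
  have hmem : AEEqFun.mk _ hm ∈ X.carrier := by
    refine X.solid _ (∑ i, |(x i : Ω →ₘ[μ] ℝ)|) ?_ (X.carrier.sum_mem fun i _ => habs i)
    rw [← AEEqFun.coeFn_le]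
    filter_upwards [AEEqFun.coeFn_abs (AEEqFun.mk _ hm), AEEqFun.coeFn_mk _ hm,
      AEEqFun.coeFn_abs (∑ i, |(x i : Ω →ₘ[μ] ℝ)|), hsum Finset.univ] with ω h1 h2 h3 h4
    rw [h1, h2, h3, h4]
    have h0 : ∀ i, 0 ≤ |(x i : Ω →ₘ[μ] ℝ) ω| := fun i => abs_nonneg _
    rw [abs_of_nonneg (Real.rpow_nonneg (Finset.sum_nonneg fun i _ => Real.rpow_nonneg (h0 i) p) _),
      abs_of_nonneg (Finset.sum_nonneg fun i _ => h0 i)]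
    exact rpow_sum_le_sum _ h0 hp
  refine ⟨⟨_, hmem⟩, AEEqFun.coeFn_mk _ hm, fun z hz => Subtype.ext (AEEqFun.ext ?_)⟩
  exact hz.trans (AEEqFun.coeFn_mk _ hm).symm

end FunctionSpace

/-- `A` is an atom of `μ`: a measurable set of positive measure every measurable subset of which
is null or of null complement in `A`. -/
def IsMeasureAtom {Ω : Type*} [MeasurableSpace Ω] (μ : Measure Ω) (A : Set Ω) : Prop :=
  MeasurableSet A ∧ 0 < μ A ∧ ∀ B ⊆ A, MeasurableSet B → μ B = 0 ∨ μ (A \ B) = 0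

/-- The norm of `E` is smooth at `x`: there is exactly one norm-one functional norming `x`. -/
def IsSmoothPoint {E : Type*} [NormedAddCommGroup E] [NormedSpace ℝ E] (x : E) : Prop :=
  ∃! φ : E →L[ℝ] ℝ, ‖φ‖ = 1 ∧ φ x = ‖x‖

/-- `F` is 1-complemented in `E`: it is the range of a linear projection of norm at most one. -/
def IsOneComplemented {E : Type*} [NormedAddCommGroup E] [NormedSpace ℝ E]
    (F : Submodule ℝ E) : Prop :=
  ∃ P : E →L[ℝ] E, (∀ x, P (P x) = P x) ∧ P.range = F ∧ ‖P‖ ≤ 1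

/-! ### Pointwise calculus, truncations, and weighted forms of convexity and concavity -/

namespace FunctionSpace

variable {Ω : Type*} [MeasurableSpace Ω] {μ : Measure Ω} {X : FunctionSpace μ}

/-! A contractive projection onto `ker g` has the form `P x = x - g x • u` with `u ≠ 0`
(`exists_rankOne`). The heart of the matter is `not_three_charged`: `g` cannot be nonzero on three
pairwise disjoint functions. Strict monotonicity shows that `g` kills everything disjoint from `u`.

To use this, perturb a kernel element `y` by `t • v`, compare `‖P (y + t • v)‖ ≤ ‖y + t • v‖` at `t`
and `-t`, and let `t → 0`. The symmetrised second-order effect has size `t ^ 2`. For `p > 2`, a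
direction `h` disjoint from `y` costs only `t ^ p`, which is smaller; so `P h` must vanish on the
support of `y`, and `g h ≠ 0` then forces `u = 0` there. For `q < 2`, the part of `u` off the
support of `y` would cost `t ^ q`, which is larger than `t ^ 2`; so there is no such part. With `y`
built from two of the three functions, either conclusion makes `g` vanish on one of the three.

Hence `Ω` splits into at most two pieces on each of which the measurable sets charged by `g` behave
like an ultrafilter. Separability gives order continuity (`tendsto_restr_of_antitone`), so this
ultrafilter is closed under decreasing countable intersections. A charged set of least measure is
then an atom, and measurable functions are constant on atoms. -/

theorem ext_ae {f h : X.carrier} (H : ∀ᵐ ω ∂μ, f.1 ω = h.1 ω) : f = h :=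
  Subtype.ext (AEEqFun.ext H)

theorem coe_add_ae (f h : X.carrier) : ∀ᵐ ω ∂μ, (f + h).1 ω = f.1 ω + h.1 ω :=
  AEEqFun.coeFn_add f.1 h.1

theorem coe_sub_ae (f h : X.carrier) : ∀ᵐ ω ∂μ, (f - h).1 ω = f.1 ω - h.1 ω :=
  AEEqFun.coeFn_sub f.1 h.1

theorem coe_smul_ae (c : ℝ) (f : X.carrier) : ∀ᵐ ω ∂μ, (c • f).1 ω = c * f.1 ω :=
  AEEqFun.coeFn_smul c f.1

theorem coe_zero_ae : ∀ᵐ ω ∂μ, (0 : X.carrier).1 ω = 0 :=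
  AEEqFun.coeFn_zero (α := Ω) (μ := μ) (β := ℝ)

theorem abs_le_abs_of_ae {f h : Ω →ₘ[μ] ℝ} (H : ∀ᵐ ω ∂μ, |f ω| ≤ |h ω|) : |f| ≤ |h| := by
  rw [← AEEqFun.coeFn_le]
  filter_upwards [H, AEEqFun.coeFn_abs f, AEEqFun.coeFn_abs h] with ω h1 h2 h3
  rwa [h2, h3]

theorem exists_of_dominated {F : Ω → ℝ} (hF : AEStronglyMeasurable F μ) (h : X.carrier)
    (H : ∀ᵐ ω ∂μ, |F ω| ≤ |h.1 ω|) : ∃ z : X.carrier, ∀ᵐ ω ∂μ, z.1 ω = F ω := by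
  have hz := AEEqFun.coeFn_mk F hF
  refine ⟨⟨AEEqFun.mk F hF, X.solid _ h.1 (abs_le_abs_of_ae ?_) h.2⟩, hz⟩
  filter_upwards [hz, H] with ω h1 h2
  rwa [h1]

theorem norm_le_of_ae {f h : X.carrier} (H : ∀ᵐ ω ∂μ, |f.1 ω| ≤ |h.1 ω|) : ‖f‖ ≤ ‖h‖ :=
  X.normFun_mono f h (abs_le_abs_of_ae H)

theorem norm_eq_of_ae {f h : X.carrier} (H : ∀ᵐ ω ∂μ, |f.1 ω| = |h.1 ω|) : ‖f‖ = ‖h‖ :=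
  le_antisymm (norm_le_of_ae (H.mono fun _ h => h.le)) (norm_le_of_ae (H.mono fun _ h => h.ge))

theorem exists_abs (f : X.carrier) : ∃ z : X.carrier, ∀ᵐ ω ∂μ, z.1 ω = |f.1 ω| :=
  exists_of_dominated f.1.aestronglyMeasurable.norm f (Eventually.of_forall fun ω => by simp)

/-- Strict monotonicity applied to the absolute values. This is the form in which a norm estimate
becomes pointwise information. -/
theorem StrictlyMonotone.ae_eq (hmono : X.StrictlyMonotone) {f h : X.carrier}
    (H : ∀ᵐ ω ∂μ, |f.1 ω| ≤ |h.1 ω|) (hn : ‖h‖ ≤ ‖f‖) : ∀ᵐ ω ∂μ, |f.1 ω| = |h.1 ω| := by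
  obtain ⟨f', hf'⟩ := exists_abs f
  obtain ⟨h', hh'⟩ := exists_abs h
  have hnf : ‖f'‖ = ‖f‖ := norm_eq_of_ae (hf'.mono fun ω h => by rw [h, abs_abs])
  have hnh : ‖h'‖ = ‖h‖ := norm_eq_of_ae (hh'.mono fun ω h => by rw [h, abs_abs])
  have heq : f' = h' := by
    by_contra hne
    refine absurd (hmono f' h' ?_ ?_ hne) (by linarith)
    · rw [← AEEqFun.coeFn_le]
      filter_upwards [hf', AEEqFun.coeFn_zero (α := Ω) (μ := μ) (β := ℝ)] with ω h1 h2
      rw [h1, h2]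
      exact abs_nonneg _
    · rw [← AEEqFun.coeFn_le]
      filter_upwards [hf', hh', H] with ω h1 h2 h3
      rwa [h1, h2]
  subst heq
  filter_upwards [hf', hh'] with ω h1 h2
  rw [← h1, ← h2]

/-- Truncation of an element of the space to a measurable set. -/
noncomputable def restr {S : Set Ω} (hS : MeasurableSet S) (f : X.carrier) : X.carrier :=
  (exists_of_dominated (f.1.aestronglyMeasurable.indicator hS) f
    (Eventually.of_forall fun ω => by
      by_cases h : ω ∈ S <;> simp [h])).choose

theorem coe_restr_ae {S : Set Ω} (hS : MeasurableSet S) (f : X.carrier) :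
    ∀ᵐ ω ∂μ, (restr hS f).1 ω = S.indicator (fun ω => f.1 ω) ω :=
  (exists_of_dominated (f.1.aestronglyMeasurable.indicator hS) f
    (Eventually.of_forall fun ω => by
      by_cases h : ω ∈ S <;> simp [h])).choose_spec

theorem norm_restr_le {S : Set Ω} (hS : MeasurableSet S) (f : X.carrier) : ‖restr hS f‖ ≤ ‖f‖ := by
  refine norm_le_of_ae ?_
  filter_upwards [coe_restr_ae hS f] with ω h
  rw [h]
  by_cases hω : ω ∈ S <;> simp [hω]

theorem restr_add {S T : Set Ω} (hS : MeasurableSet S) (hT : MeasurableSet T)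
    (hd : Disjoint S T) (f : X.carrier) : restr hS f + restr hT f = restr (hS.union hT) f := by
  refine ext_ae ?_
  filter_upwards [coe_restr_ae hS f, coe_restr_ae hT f, coe_restr_ae (hS.union hT) f,
    coe_add_ae (restr hS f) (restr hT f)] with ω h1 h2 h3 h4
  rw [h4, h1, h2, h3, Set.indicator_union_of_disjoint hd]

theorem restr_eq_self {S : Set Ω} (hS : MeasurableSet S) {f : X.carrier}
    (h : ∀ᵐ ω ∂μ, ω ∉ S → f.1 ω = 0) : restr hS f = f := by
  refine ext_ae ?_
  filter_upwards [coe_restr_ae hS f, h] with ω h1 h2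
  by_cases hω : ω ∈ S
  · simp [h1, hω]
  · simp [h1, hω, h2 hω]

theorem restr_add_compl {S : Set Ω} (hS : MeasurableSet S) (f : X.carrier) :
    restr hS f + restr hS.compl f = f := by
  rw [restr_add hS hS.compl disjoint_compl_right]
  exact restr_eq_self _ (Eventually.of_forall fun ω h => absurd (Set.mem_univ ω) (by
    rwa [Set.union_compl_self] at h))

theorem restr_restr {S T : Set Ω} (hS : MeasurableSet S) (hT : MeasurableSet T) (f : X.carrier) :
    restr hS (restr hT f) = restr (hS.inter hT) f := by
  refine ext_ae ?_
  filter_upwards [coe_restr_ae hS (restr hT f), coe_restr_ae hT f,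
    coe_restr_ae (hS.inter hT) f] with ω h1 h2 h3
  rw [h1, h3]
  by_cases hω : ω ∈ S <;> by_cases hω' : ω ∈ T <;> simp [hω, hω', h2]

theorem restr_sub {S : Set Ω} (hS : MeasurableSet S) (f h : X.carrier) :
    restr hS (f - h) = restr hS f - restr hS h := by
  refine ext_ae ?_
  filter_upwards [coe_restr_ae hS (f - h), coe_restr_ae hS f, coe_restr_ae hS h,
    coe_sub_ae f h, coe_sub_ae (restr hS f) (restr hS h)] with ω h1 h2 h3 h4 h5
  rw [h1, h5, h2, h3]
  by_cases hω : ω ∈ S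
  · simpa only [Set.indicator_of_mem hω] using h4
  · simp [hω]

theorem restr_ae_eq_zero {S : Set Ω} (hS : MeasurableSet S) (f : X.carrier) :
    ∀ᵐ ω ∂μ, ω ∉ S → (restr hS f).1 ω = 0 := by
  filter_upwards [coe_restr_ae hS f] with ω h hω
  simp [h, hω]

/-- Weighted form of one-`p`-convexity. -/
theorem OneConvex.norm_rpow_le {p : ℝ} (hp : 1 ≤ p) (hX : X.OneConvex p) {n : ℕ}
    (c : Fin n → ℝ) (hc : ∀ i, 0 ≤ c i) (x : Fin n → X.carrier) (y : X.carrier)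
    (H : ∀ᵐ ω ∂μ, |y.1 ω| ^ p ≤ ∑ i, c i * |(x i).1 ω| ^ p) :
    ‖y‖ ^ p ≤ ∑ i, c i * ‖x i‖ ^ p := by
  have hp0 : 0 < p := by linarith
  have hr : ∀ i, (c i ^ (1 / p)) ^ p = c i := fun i => by
    rw [one_div, Real.rpow_inv_rpow (hc i) hp0.ne']
  have hs : ∀ i, 0 ≤ c i ^ (1 / p) := fun i => Real.rpow_nonneg (hc i) _
  obtain ⟨z, hz, -⟩ := existsUnique_isPowerSum hp fun i => c i ^ (1 / p) • x i
  have h1 := hX n _ z hz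
  have h2 : ‖y‖ ≤ ‖z‖ := by
    refine norm_le_of_ae ?_
    filter_upwards [H, hz, ae_all_iff.2 fun i => coe_smul_ae (c i ^ (1 / p)) (x i)] with ω a1 a2 a3
    have : ∑ i, |(c i ^ (1 / p) • x i).1 ω| ^ p = ∑ i, c i * |(x i).1 ω| ^ p :=
      Finset.sum_congr rfl fun i _ => by
        rw [a3, abs_mul, Real.mul_rpow (abs_nonneg _) (abs_nonneg _), abs_of_nonneg (hs i), hr]
    rw [a2, this, abs_of_nonneg (Real.rpow_nonneg ((Real.rpow_nonneg (abs_nonneg _) _).trans a1) _)]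
    calc |y.1 ω| = (|y.1 ω| ^ p) ^ (1 / p) := by
          rw [one_div, Real.rpow_rpow_inv (abs_nonneg _) hp0.ne']
      _ ≤ _ := Real.rpow_le_rpow (Real.rpow_nonneg (abs_nonneg _) _) a1 (by positivity)
  have h3 : ∑ i, ‖c i ^ (1 / p) • x i‖ ^ p = ∑ i, c i * ‖x i‖ ^ p :=
    Finset.sum_congr rfl fun i _ => by
      rw [norm_smul, Real.mul_rpow (norm_nonneg _) (norm_nonneg _), Real.norm_of_nonneg (hs i), hr]
  have h4 : 0 ≤ ∑ i, c i * ‖x i‖ ^ p :=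
    Finset.sum_nonneg fun i _ => mul_nonneg (hc i) (Real.rpow_nonneg (norm_nonneg _) _)
  rw [h3] at h1
  calc ‖y‖ ^ p ≤ ((∑ i, c i * ‖x i‖ ^ p) ^ (1 / p)) ^ p :=
        Real.rpow_le_rpow (norm_nonneg _) (h2.trans h1) hp0.le
    _ = _ := by rw [one_div, Real.rpow_inv_rpow h4 hp0.ne']

/-- Form of one-`q`-concavity for a dominated power sum. -/
theorem OneConcave.sum_norm_rpow_le {q : ℝ} (hq : 1 ≤ q) (hX : X.OneConcave q) {n : ℕ}
    (x : Fin n → X.carrier) (y : X.carrier)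
    (H : ∀ᵐ ω ∂μ, ∑ i, |(x i).1 ω| ^ q ≤ |y.1 ω| ^ q) :
    ∑ i, ‖x i‖ ^ q ≤ ‖y‖ ^ q := by
  have hq0 : 0 < q := by linarith
  obtain ⟨z, hz, -⟩ := existsUnique_isPowerSum hq x
  have h1 := hX n _ z hz
  have h2 : ‖z‖ ≤ ‖y‖ := by
    refine norm_le_of_ae ?_
    filter_upwards [H, hz] with ω a1 a2
    have h0 : 0 ≤ ∑ i, |(x i).1 ω| ^ q :=
      Finset.sum_nonneg fun i _ => Real.rpow_nonneg (abs_nonneg _) _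
    rw [a2, abs_of_nonneg (Real.rpow_nonneg h0 _)]
    calc _ ≤ (|y.1 ω| ^ q) ^ (1 / q) := Real.rpow_le_rpow h0 a1 (by positivity)
      _ = |y.1 ω| := by rw [one_div, Real.rpow_rpow_inv (abs_nonneg _) hq0.ne']
  have h0 : 0 ≤ ∑ i, ‖x i‖ ^ q := Finset.sum_nonneg fun i _ => Real.rpow_nonneg (norm_nonneg _) _
  calc ∑ i, ‖x i‖ ^ q = ((∑ i, ‖x i‖ ^ q) ^ (1 / q)) ^ q := by
        rw [one_div, Real.rpow_inv_rpow h0 hq0.ne']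
    _ ≤ ‖y‖ ^ q := Real.rpow_le_rpow (Real.rpow_nonneg h0 _) (h1.trans h2) hq0.le

end FunctionSpace

/-! ### Rank-one form of the projection, and scalar inequalities -/

/-- If `g x₀ = 1`, then `x - g x • x₀` lies in the kernel and is fixed by `P`, so `P x = x - g x •
u` with `u = x₀ - P x₀`. -/
theorem IsOneComplemented.exists_rankOne {E : Type*} [NormedAddCommGroup E] [NormedSpace ℝ E]
    {g : E →L[ℝ] ℝ} (hg : g ≠ 0) (h : IsOneComplemented g.ker) :
    ∃ u : E, u ≠ 0 ∧ ∀ x, ‖x - g x • u‖ ≤ ‖x‖ := by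
  obtain ⟨P, hP, hr, hn⟩ := h
  obtain ⟨x₁, hx₁⟩ : ∃ x, g x ≠ 0 := by
    by_contra! H
    exact hg (ContinuousLinearMap.ext H)
  obtain ⟨x₀, hx₀⟩ : ∃ x, g x = 1 := ⟨(g x₁)⁻¹ • x₁, by simp [hx₁]⟩
  have hker : ∀ x, g (P x) = 0 := fun x => by
    have : P x ∈ g.ker := hr ▸ LinearMap.mem_range_self _ x
    exact this
  have hfix : ∀ x, g x = 0 → P x = x := fun x hx => by
    have hx' : x ∈ g.ker := hx
    rw [← hr] at hx'
    obtain ⟨z, hz⟩ := hx'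
    have hz' : P z = x := hz
    rw [← hz', hP]
  refine ⟨x₀ - P x₀, fun h0 => ?_, fun x => ?_⟩
  · have := hker x₀
    rw [← sub_eq_zero.1 h0, hx₀] at this
    exact one_ne_zero this
  · have h1 := hfix (x - g x • x₀) (by simp [hx₀])
    have h2 : x - g x • (x₀ - P x₀) = P x := by
      rw [map_sub, map_smul] at h1
      rw [smul_sub, ← sub_add, ← h1, sub_add_cancel]
    rw [h2]
    exact (P.le_opNorm x).trans (mul_le_of_le_one_left (norm_nonneg _) hn)

/-- Jensen for the convex function `s ↦ s ^ (p / 2)` at the squares `(y ± t v) ^ 2` and `y ^ 2 - w`.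
The weights, proportional to `1, 1, 2 t ^ 2`, are chosen so that the mean is `y ^ 2 + t ^ 2 (v ^ 2 -
w) / (1 + t ^ 2) ≥ y ^ 2`. -/
theorem two_mul_rpow_le_abs_add_sub {p : ℝ} (hp : 2 ≤ p) {y v w : ℝ} (hw : w ≤ y ^ 2)
    (hwv : w ≤ v ^ 2) (t : ℝ) :
    2 * (1 + t ^ 2) * |y| ^ p ≤
      |y + t * v| ^ p + |y - t * v| ^ p + 2 * t ^ 2 * √(y ^ 2 - w) ^ p := by
  have key : ∀ x : ℝ, |x| ^ p = (x ^ 2) ^ (p / 2) := fun x => by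
    rw [← sq_abs, ← Real.rpow_natCast, ← Real.rpow_mul (abs_nonneg x)]
    congr 1
    push_cast
    ring
  have hb : √(y ^ 2 - w) ^ p = (y ^ 2 - w) ^ (p / 2) := by
    rw [← abs_of_nonneg (Real.sqrt_nonneg (y ^ 2 - w)), key, Real.sq_sqrt (by linarith)]
  have ht : 0 < 1 + t ^ 2 := by positivity
  have h := Real.rpow_arith_mean_le_arith_mean_rpow (Finset.univ : Finset (Fin 3))
    ![1 / (2 * (1 + t ^ 2)), 1 / (2 * (1 + t ^ 2)), 2 * t ^ 2 / (2 * (1 + t ^ 2))]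
    ![(y + t * v) ^ 2, (y - t * v) ^ 2, y ^ 2 - w]
    (by intro i _; fin_cases i <;> simp <;> positivity)
    (by simp [Fin.sum_univ_three]; field_simp; ring)
    (by
      intro i _
      fin_cases i
      · exact sq_nonneg _
      · exact sq_nonneg _
      · simpa using hw) (p := p / 2) (by linarith)
  simp only [Fin.sum_univ_three, Matrix.cons_val_zero, Matrix.cons_val_one, Matrix.cons_val] at h
  rw [key, key, key, hb]
  have h1 : (y ^ 2) ^ (p / 2) ≤ (1 / (2 * (1 + t ^ 2)) * (y + t * v) ^ 2 +
      1 / (2 * (1 + t ^ 2)) * (y - t * v) ^ 2 +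
      2 * t ^ 2 / (2 * (1 + t ^ 2)) * (y ^ 2 - w)) ^ (p / 2) := by
    refine Real.rpow_le_rpow (sq_nonneg _) ?_ (by linarith)
    have : 1 / (2 * (1 + t ^ 2)) * (y + t * v) ^ 2 + 1 / (2 * (1 + t ^ 2)) * (y - t * v) ^ 2 +
      2 * t ^ 2 / (2 * (1 + t ^ 2)) * (y ^ 2 - w) = y ^ 2 + t ^ 2 * (v ^ 2 - w) / (1 + t ^ 2) := by
      field_simp
      ring
    rw [this]
    have : 0 ≤ t ^ 2 * (v ^ 2 - w) / (1 + t ^ 2) :=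
      div_nonneg (mul_nonneg (sq_nonneg _) (by linarith)) ht.le
    linarith
  have h2 := mul_le_mul_of_nonneg_left (h1.trans h) (by positivity : 0 ≤ 2 * (1 + t ^ 2))
  refine h2.trans (le_of_eq ?_)
  field_simp

/-- Concavity of `s ↦ s ^ (q / 2)`: the squares `(y ± t v) ^ 2` have mean `y ^ 2 + t ^ 2 v ^ 2 ≤ (1
+ t ^ 2) y ^ 2`, and `(1 + t ^ 2) ^ (q / 2) ≤ 1 + t ^ 2`. -/
theorem abs_add_sub_rpow_le {q : ℝ} (hq : 0 < q) (hq2 : q ≤ 2) {y v : ℝ} (hv : |v| ≤ |y|) (t : ℝ) :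
    |y + t * v| ^ q + |y - t * v| ^ q ≤ 2 * (1 + t ^ 2) * |y| ^ q := by
  have key : ∀ x : ℝ, |x| ^ q = (x ^ 2) ^ (q / 2) := fun x => by
    rw [← sq_abs, ← Real.rpow_natCast, ← Real.rpow_mul (abs_nonneg x)]
    congr 1
    push_cast
    ring
  have h := (Real.concaveOn_rpow (p := q / 2) (by positivity) (by linarith)).2
    (Set.mem_Ici.2 (sq_nonneg (y + t * v))) (Set.mem_Ici.2 (sq_nonneg (y - t * v)))
    (by norm_num : (0 : ℝ) ≤ 1 / 2) (by norm_num : (0 : ℝ) ≤ 1 / 2) (by norm_num)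
  simp only [smul_eq_mul] at h
  have h1 : (1 / 2 * (y + t * v) ^ 2 + 1 / 2 * (y - t * v) ^ 2) ^ (q / 2) ≤
      ((1 + t ^ 2) * y ^ 2) ^ (q / 2) := by
    refine Real.rpow_le_rpow (by positivity) ?_ (by positivity)
    nlinarith [mul_nonneg (sq_nonneg t) (sub_nonneg.2 (sq_le_sq.2 hv))]
  rw [Real.mul_rpow (by positivity) (sq_nonneg _)] at h1
  have h2 : (1 + t ^ 2) ^ (q / 2) ≤ 1 + t ^ 2 := by
    calc (1 + t ^ 2) ^ (q / 2) ≤ (1 + t ^ 2) ^ (1 : ℝ) :=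
          Real.rpow_le_rpow_of_exponent_le (by nlinarith [sq_nonneg t]) (by linarith)
      _ = _ := Real.rpow_one _
  have h3 := mul_le_mul_of_nonneg_right h2 (Real.rpow_nonneg (sq_nonneg y) (q / 2))
  rw [key, key, key]
  linarith

theorem nonpos_of_forall_mul_le_rpow {a b r : ℝ} (hr : 0 < r)
    (H : ∀ t : ℝ, 0 < t → a ≤ t ^ r * b) : a ≤ 0 := by
  have h : Tendsto (fun t : ℝ => t ^ r * b) (nhdsWithin 0 (Set.Ioi 0)) (nhds (0 ^ r * b)) :=
    ((Real.continuousAt_rpow_const 0 r (Or.inr hr.le)).mul continuousAt_const).mono_left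
      nhdsWithin_le_nhds
  rw [Real.zero_rpow hr.ne', zero_mul] at h
  exact ge_of_tendsto h (eventually_mem_nhdsWithin.mono fun t ht => H t ht)

/-! ### The perturbation argument: no three disjoint charged sets -/

namespace FunctionSpace

variable {Ω : Type*} [MeasurableSpace Ω] {μ : Measure Ω} {X : FunctionSpace μ}

/-- By disjointness `|h| ≤ |h - g h • u|`, while the projection does not increase the norm. Strict
monotonicity makes the moduli equal, which is impossible if `g h ≠ 0` and `u ≠ 0`. -/
theorem StrictlyMonotone.apply_eq_zero (hmono : X.StrictlyMonotone) {g : X.carrier →L[ℝ] ℝ}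
    {u : X.carrier} (hu : u ≠ 0) (hP : ∀ x, ‖x - g x • u‖ ≤ ‖x‖) {h : X.carrier}
    (hd : ∀ᵐ ω ∂μ, h.1 ω = 0 ∨ u.1 ω = 0) : g h = 0 := by
  by_contra hgh
  have hae : ∀ᵐ ω ∂μ, (h - g h • u).1 ω = h.1 ω - g h * u.1 ω := by
    filter_upwards [coe_sub_ae h (g h • u), coe_smul_ae (g h) u] with ω h1 h2
    rw [h1, h2]
  have heq := hmono.ae_eq (f := h) (h := h - g h • u) (by
    filter_upwards [hae, hd] with ω h1 h2
    rw [h1]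
    rcases h2 with h2 | h2
    · rw [h2, abs_zero]
      exact abs_nonneg _
    · simp [h2]) (hP h)
  refine hu (ext_ae ?_)
  filter_upwards [hae, hd, heq, coe_zero_ae (X := X)] with ω h1 h2 h3 h4
  rw [h4]
  rcases h2 with h2 | h2
  · rw [h1, h2] at h3
    simpa [hgh] using h3.symm
  · exact h2

/-- In a strictly monotone, one-`p`-convex space with `p > 2`, an element of the kernel that meets
the support of `u` is disjoint only from elements of the kernel. -/
theorem OneConvex.apply_eq_zero_of_disjoint (hmono : X.StrictlyMonotone) {p : ℝ} (hp : 2 < p)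
    (hX : X.OneConvex p) {g : X.carrier →L[ℝ] ℝ} {u : X.carrier}
    (hP : ∀ x, ‖x - g x • u‖ ≤ ‖x‖) {y h : X.carrier} (hy : g y = 0)
    (hd : ∀ᵐ ω ∂μ, y.1 ω = 0 ∨ h.1 ω = 0) (hyu : ¬ ∀ᵐ ω ∂μ, y.1 ω = 0 ∨ u.1 ω = 0) :
    g h = 0 := by
  by_contra hgh
  have hp0 : 0 < p := by linarith
  set v := h - g h • u with hv
  have hae : ∀ᵐ ω ∂μ, v.1 ω = h.1 ω - g h * u.1 ω := by
    filter_upwards [coe_sub_ae h (g h • u), coe_smul_ae (g h) u] with ω h1 h2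
    rw [h1, h2]
  -- The third point of the scalar inequality with `w = min (y ^ 2) (v ^ 2)`: `b` has modulus at
  -- most `|y|`, strictly smaller exactly where `y` and `v` are both nonzero.
  obtain ⟨b, hb⟩ := exists_of_dominated (X := X)
    (F := fun ω => √(y.1 ω ^ 2 - min (y.1 ω ^ 2) (v.1 ω ^ 2))) (by
      apply AEMeasurable.aestronglyMeasurable
      have h1 := y.1.aestronglyMeasurable.aemeasurable
      have h2 := v.1.aestronglyMeasurable.aemeasurable
      fun_prop) y (Eventually.of_forall fun ω => by
        rw [abs_of_nonneg (Real.sqrt_nonneg _), ← Real.sqrt_sq_eq_abs]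
        refine Real.sqrt_le_sqrt ?_
        have : 0 ≤ min (y.1 ω ^ 2) (v.1 ω ^ 2) := le_min (sq_nonneg _) (sq_nonneg _)
        linarith)
  -- The projection sends `y + t • h` to `y + t • v`, and `y`, `h` are disjoint, so `p`-convexity
  -- bounds the increment by order `|t| ^ p`.
  have hsub : ∀ t : ℝ, ‖y + t • v‖ ^ p ≤ ‖y‖ ^ p + |t| ^ p * ‖h‖ ^ p := fun t => by
    have h1 : ‖y + t • v‖ ≤ ‖y + t • h‖ := by
      have h2 := hP (y + t • h)
      rw [map_add, map_smul, hy, zero_add, smul_eq_mul, mul_smul] at h2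
      rwa [hv, smul_sub, ← add_sub_assoc]
    refine (Real.rpow_le_rpow (norm_nonneg _) h1 hp0.le).trans ?_
    have h3 := hX.norm_rpow_le (by linarith) ![1, |t| ^ p] (by
      intro i
      fin_cases i
      · exact zero_le_one
      · exact Real.rpow_nonneg (abs_nonneg t) _) ![y, h] (y + t • h) (by
        filter_upwards [coe_add_ae y (t • h), coe_smul_ae t h, hd] with ω a1 a2 a3
        rw [a1, a2]
        rcases a3 with a3 | a3 <;>
          simp [Fin.sum_univ_two, a3, abs_mul, Real.zero_rpow hp0.ne',
            Real.mul_rpow (abs_nonneg t) (abs_nonneg (h.1 ω))])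
    simpa [Fin.sum_univ_two] using h3
  -- `p`-convexity transfers the scalar inequality to norms. Adding `hsub` at `±t` leaves `2 t ^ 2
  -- (‖y‖ ^ p - ‖b‖ ^ p) ≤ 2 t ^ p ‖h‖ ^ p`.
  have hmain : ∀ t : ℝ, 0 < t → ‖y‖ ^ p - ‖b‖ ^ p ≤ t ^ (p - 2) * ‖h‖ ^ p := fun t ht => by
    have h1 := hX.norm_rpow_le (by linarith)
      ![1 / (2 * (1 + t ^ 2)), 1 / (2 * (1 + t ^ 2)), 2 * t ^ 2 / (2 * (1 + t ^ 2))]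
      (by intro i; fin_cases i <;> simp <;> positivity) ![y + t • v, y + (-t) • v, b] y (by
        filter_upwards [coe_add_ae y (t • v), coe_add_ae y ((-t) • v), coe_smul_ae t v,
          coe_smul_ae (-t) v, hb] with ω a1 a2 a3 a4 a5
        have h2 := two_mul_rpow_le_abs_add_sub hp.le (min_le_left (y.1 ω ^ 2) (v.1 ω ^ 2))
          (min_le_right _ _) t
        simp only [Fin.sum_univ_three, Matrix.cons_val_zero, Matrix.cons_val_one, Matrix.cons_val]
        rw [a1, a2, a3, a4, a5, abs_of_nonneg (Real.sqrt_nonneg _), neg_mul, ← sub_eq_add_neg]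
        have : 0 < 2 * (1 + t ^ 2) := by positivity
        field_simp
        linarith)
    simp only [Fin.sum_univ_three, Matrix.cons_val_zero, Matrix.cons_val_one, Matrix.cons_val] at h1
    have h2 := hsub t
    have h3 := hsub (-t)
    rw [abs_neg, abs_of_pos ht] at h3
    rw [abs_of_pos ht] at h2
    have h4 : t ^ p = t ^ 2 * t ^ (p - 2) := by
      rw [← Real.rpow_natCast, ← Real.rpow_add ht]
      congr 1
      push_cast
      ring
    have h5 : 0 < 2 * (1 + t ^ 2) := by positivity
    have h6 : 2 * (1 + t ^ 2) * ‖y‖ ^ p ≤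
        ‖y + t • v‖ ^ p + ‖y + (-t) • v‖ ^ p + 2 * t ^ 2 * ‖b‖ ^ p := by
      refine (mul_le_mul_of_nonneg_left h1 h5.le).trans (le_of_eq ?_)
      field_simp
    rw [h4] at h2 h3
    have h7 : 0 < t ^ 2 := by positivity
    refine le_of_mul_le_mul_left ?_ h7
    linarith
  have hyb : ‖y‖ ≤ ‖b‖ := by
    have := nonpos_of_forall_mul_le_rpow (by linarith) hmain
    exact (Real.rpow_le_rpow_iff (norm_nonneg _) (norm_nonneg _) hp0).1 (by linarith)
  have heq := hmono.ae_eq (f := b) (h := y) (by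
    filter_upwards [hb] with ω h1
    rw [h1, abs_of_nonneg (Real.sqrt_nonneg _), ← Real.sqrt_sq_eq_abs]
    refine Real.sqrt_le_sqrt ?_
    have : 0 ≤ min (y.1 ω ^ 2) (v.1 ω ^ 2) := le_min (sq_nonneg _) (sq_nonneg _)
    linarith) hyb
  refine hyu ?_
  filter_upwards [heq, hb, hae, hd] with ω h1 h2 h3 h4
  by_contra! H
  have h5 : h.1 ω = 0 := h4.resolve_left H.1
  have h6 : v.1 ω ≠ 0 := by rw [h3, h5, zero_sub]; exact neg_ne_zero.2 (mul_ne_zero hgh H.2)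
  have h7 : 0 < min (y.1 ω ^ 2) (v.1 ω ^ 2) :=
    lt_min (by have := H.1; positivity) (by positivity)
  rw [h2, abs_of_nonneg (Real.sqrt_nonneg _), ← Real.sqrt_sq_eq_abs] at h1
  have h8 := Real.sqrt_lt_sqrt (x := y.1 ω ^ 2 - min (y.1 ω ^ 2) (v.1 ω ^ 2)) (y := y.1 ω ^ 2)
    (by linarith [min_le_left (y.1 ω ^ 2) (v.1 ω ^ 2)]) (by linarith)
  exact h8.ne h1

/-- In a one-`q`-concave space with `q < 2`, an element of the kernel whose order ideal is not
contained in the kernel has at least the support of `u`. -/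
theorem OneConcave.ae_eq_zero_of_apply_ne_zero {q : ℝ} (hq : 1 < q) (hq2 : q < 2)
    (hX : X.OneConcave q) {g : X.carrier →L[ℝ] ℝ} {u : X.carrier}
    (hP : ∀ x, ‖x - g x • u‖ ≤ ‖x‖) {y v : X.carrier} (hy : g y = 0) (hv : g v ≠ 0)
    (hvy : ∀ᵐ ω ∂μ, |v.1 ω| ≤ |y.1 ω|) : ∀ᵐ ω ∂μ, y.1 ω = 0 → u.1 ω = 0 := by
  have hq0 : 0 < q := by linarith
  have hE : MeasurableSet {ω | y.1 ω = 0} :=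
    y.1.stronglyMeasurable.measurable (measurableSet_singleton 0)
  set k := restr hE u with hk
  set w := v - g v • u with hw
  have hae : ∀ᵐ ω ∂μ, w.1 ω = v.1 ω - g v * u.1 ω := by
    filter_upwards [coe_sub_ae v (g v • u), coe_smul_ae (g v) u] with ω h1 h2
    rw [h1, h2]
  -- The projection sends `y + t • v` to `y + t • w`. Where `y = 0` also `v = 0`, so there it equals
  -- `-t (g v) u`, and `q`-concavity separates this part from the rest.
  have hlow : ∀ t : ℝ, ‖restr hE.compl (y + t • w)‖ ^ q + |t| ^ q * (|g v| * ‖k‖) ^ q ≤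
      ‖y + t • v‖ ^ q := fun t => by
    have h1 : ‖y + t • w‖ ≤ ‖y + t • v‖ := by
      have h2 := hP (y + t • v)
      rw [map_add, map_smul, hy, zero_add, smul_eq_mul, mul_smul] at h2
      rwa [hw, smul_sub, ← add_sub_assoc]
    refine le_trans ?_ (Real.rpow_le_rpow (norm_nonneg _) h1 hq0.le)
    have h3 := hX.sum_norm_rpow_le hq.le ![restr hE.compl (y + t • w), (t * g v) • k] (y + t • w) (by
      filter_upwards [coe_restr_ae hE.compl (y + t • w), coe_smul_ae (t * g v) k,
        coe_restr_ae hE u, coe_add_ae y (t • w), coe_smul_ae t w, hae, hvy]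
        with ω a1 a2 a3 a4 a5 a6 a7
      simp only [Fin.sum_univ_two, Matrix.cons_val_zero, Matrix.cons_val_one]
      rw [a1, a2, hk, a3]
      by_cases hω : y.1 ω = 0
      · have h5 : v.1 ω = 0 := by simpa [hω] using a7
        rw [a4, a5, a6]
        simp [hω, h5, Real.zero_rpow hq0.ne', abs_mul, mul_assoc]
      · simp [hω, Real.zero_rpow hq0.ne'])
    simp only [Fin.sum_univ_two, Matrix.cons_val_zero, Matrix.cons_val_one] at h3
    rwa [norm_smul, Real.norm_eq_abs, abs_mul, mul_assoc,
      Real.mul_rpow (abs_nonneg t) (by positivity)] at h3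
  -- The two truncations average to `y`, so this is convexity of the norm and of `s ↦ s ^ q`.
  have hmid : ∀ t : ℝ, 2 * ‖y‖ ^ q ≤
      ‖restr hE.compl (y + t • w)‖ ^ q + ‖restr hE.compl (y + (-t) • w)‖ ^ q := fun t => by
    have h1 : restr hE.compl (y + t • w) + restr hE.compl (y + (-t) • w) = (2 : ℝ) • y := by
      refine ext_ae ?_
      filter_upwards [coe_restr_ae hE.compl (y + t • w), coe_restr_ae hE.compl (y + (-t) • w),
        coe_add_ae (restr hE.compl (y + t • w)) (restr hE.compl (y + (-t) • w)),
        coe_add_ae y (t • w), coe_smul_ae t w, coe_add_ae y ((-t) • w), coe_smul_ae (-t) w,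
        coe_smul_ae 2 y] with ω a1 a2 a3 a4 a5 a6 a7 a8
      rw [a3, a1, a2, a8]
      by_cases hω : y.1 ω = 0
      · simp [hω]
      · rw [Set.indicator_of_mem (by exact hω), Set.indicator_of_mem (by exact hω), a4, a5, a6, a7]
        ring
    have h2 := norm_add_le (restr hE.compl (y + t • w)) (restr hE.compl (y + (-t) • w))
    rw [h1, norm_smul, Real.norm_of_nonneg zero_le_two] at h2
    set A := ‖restr hE.compl (y + t • w)‖
    set B := ‖restr hE.compl (y + (-t) • w)‖
    have h3 := (convexOn_rpow hq.le).2 (Set.mem_Ici.2 (norm_nonneg (restr hE.compl (y + t • w))))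
      (Set.mem_Ici.2 (norm_nonneg (restr hE.compl (y + (-t) • w))))
      (by norm_num : (0 : ℝ) ≤ 1 / 2) (by norm_num : (0 : ℝ) ≤ 1 / 2) (by norm_num)
    simp only [smul_eq_mul] at h3
    have h4 : ‖y‖ ^ q ≤ (1 / 2 * A + 1 / 2 * B) ^ q :=
      Real.rpow_le_rpow (norm_nonneg _) (by linarith) hq0.le
    linarith
  -- The multiple `(2 (1 + t ^ 2)) ^ (1 / q) • y` dominates the power sum of `y ± t • v` by the
  -- scalar inequality.
  have hup : ∀ t : ℝ, ‖y + t • v‖ ^ q + ‖y + (-t) • v‖ ^ q ≤ 2 * (1 + t ^ 2) * ‖y‖ ^ q := fun t => by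
    have hc : 0 ≤ 2 * (1 + t ^ 2) := by positivity
    have hc' : 0 ≤ (2 * (1 + t ^ 2)) ^ (1 / q) := Real.rpow_nonneg hc _
    have hcq : ((2 * (1 + t ^ 2)) ^ (1 / q)) ^ q = 2 * (1 + t ^ 2) := by
      rw [one_div, Real.rpow_inv_rpow hc hq0.ne']
    have h3 := hX.sum_norm_rpow_le hq.le ![y + t • v, y + (-t) • v]
      ((2 * (1 + t ^ 2)) ^ (1 / q) • y) (by
        filter_upwards [coe_add_ae y (t • v), coe_smul_ae t v, coe_add_ae y ((-t) • v),
          coe_smul_ae (-t) v, coe_smul_ae ((2 * (1 + t ^ 2)) ^ (1 / q)) y, hvy]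
          with ω a1 a2 a3 a4 a5 a6
        simp only [Fin.sum_univ_two, Matrix.cons_val_zero, Matrix.cons_val_one]
        rw [a5, abs_mul, Real.mul_rpow (abs_nonneg _) (abs_nonneg _), abs_of_nonneg hc', hcq,
          a1, a2, a3, a4, neg_mul, ← sub_eq_add_neg]
        exact abs_add_sub_rpow_le hq0 hq2.le a6 t)
    simp only [Fin.sum_univ_two, Matrix.cons_val_zero, Matrix.cons_val_one] at h3
    rwa [norm_smul, Real.norm_of_nonneg hc', Real.mul_rpow hc' (norm_nonneg _), hcq] at h3
  have hmain : ∀ t : ℝ, 0 < t → (|g v| * ‖k‖) ^ q ≤ t ^ (2 - q) * ‖y‖ ^ q := fun t ht => by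
    have h1 := hlow t
    have h2 := hlow (-t)
    have h3 := hmid t
    have h4 := hup t
    rw [abs_neg, abs_of_pos ht] at h2
    rw [abs_of_pos ht] at h1
    have h5 : t ^ 2 = t ^ q * t ^ (2 - q) := by
      rw [← Real.rpow_natCast, ← Real.rpow_add ht]
      congr 1
      push_cast
      ring
    rw [h5] at h4
    refine le_of_mul_le_mul_left ?_ (Real.rpow_pos_of_pos ht q)
    linarith
  have hk0 : ‖k‖ = 0 := by
    by_contra hne
    have h1 : 0 < |g v| * ‖k‖ := mul_pos (abs_pos.2 hv) (lt_of_le_of_ne (norm_nonneg _) (Ne.symm hne))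
    exact absurd (nonpos_of_forall_mul_le_rpow (by linarith) hmain)
      (not_le.2 (Real.rpow_pos_of_pos h1 q))
  rw [norm_eq_zero] at hk0
  filter_upwards [coe_restr_ae hE u, coe_zero_ae (X := X)] with ω h1 h2 hω
  rw [← hk, hk0, h2] at h1
  simpa [hω] using h1.symm

/-- `S` carries part of `g`: some element of the space vanishing off `S` is not in the kernel. -/
def Charged (g : X.carrier →L[ℝ] ℝ) (S : Set Ω) : Prop :=
  ∃ f : X.carrier, (∀ᵐ ω ∂μ, ω ∉ S → f.1 ω = 0) ∧ g f ≠ 0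

/-- Combine two of the functions into a kernel element `y`. In the convex case the third function
forces `y`, hence `f₁`, to be disjoint from `u`; in the concave case `u` lives on the support of
`y`, so `f₃` is disjoint from `u`. Either way `g` kills a function it should not. -/
theorem not_three_charged (hmono : X.StrictlyMonotone)
    (hX : (∃ p : ℝ, 2 < p ∧ X.OneConvex p) ∨ ∃ q : ℝ, 1 < q ∧ q < 2 ∧ X.OneConcave q)
    {g : X.carrier →L[ℝ] ℝ} (hg : g ≠ 0) (hker : IsOneComplemented g.ker) {S₁ S₂ S₃ : Set Ω}
    (h12 : Disjoint S₁ S₂) (h13 : Disjoint S₁ S₃) (h23 : Disjoint S₂ S₃)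
    (h1 : Charged g S₁) (h2 : Charged g S₂) (h3 : Charged g S₃) : False := by
  obtain ⟨u, hu, hP⟩ := hker.exists_rankOne hg
  obtain ⟨f₁, hf₁, hg₁⟩ := h1
  obtain ⟨f₂, hf₂, hg₂⟩ := h2
  obtain ⟨f₃, hf₃, hg₃⟩ := h3
  set y := (g f₁)⁻¹ • f₁ - (g f₂)⁻¹ • f₂ with hy
  have hgy : g y = 0 := by simp [hy, hg₁, hg₂]
  have hyae : ∀ᵐ ω ∂μ, y.1 ω = (g f₁)⁻¹ * f₁.1 ω - (g f₂)⁻¹ * f₂.1 ω := by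
    filter_upwards [coe_sub_ae ((g f₁)⁻¹ • f₁) ((g f₂)⁻¹ • f₂), coe_smul_ae (g f₁)⁻¹ f₁,
      coe_smul_ae (g f₂)⁻¹ f₂] with ω a1 a2 a3
    rw [a1, a2, a3]
  have hd12 : ∀ᵐ ω ∂μ, f₁.1 ω = 0 ∨ f₂.1 ω = 0 := by
    filter_upwards [hf₁, hf₂] with ω a1 a2
    by_cases hω : ω ∈ S₁
    · exact Or.inr (a2 (Set.disjoint_left.1 h12 hω))
    · exact Or.inl (a1 hω)
  have hd : ∀ᵐ ω ∂μ, y.1 ω = 0 ∨ f₃.1 ω = 0 := by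
    filter_upwards [hf₁, hf₂, hf₃, hyae] with ω a1 a2 a3 a4
    by_cases hω : ω ∈ S₃
    · left
      rw [a4, a1 (Set.disjoint_right.1 h13 hω), a2 (Set.disjoint_right.1 h23 hω)]
      simp
    · exact Or.inr (a3 hω)
  rcases hX with ⟨p, hp, hX⟩ | ⟨q, hq, hq2, hX⟩
  · refine hg₃ (hX.apply_eq_zero_of_disjoint hmono hp hP hgy hd fun H => hg₁ ?_)
    refine hmono.apply_eq_zero hu hP ?_
    filter_upwards [H, hd12, hyae] with ω a1 a2 a3
    refine a1.imp_left fun h0 => ?_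
    rcases a2 with a2 | a2
    · exact a2
    · rw [a2, h0] at a3
      simpa [hg₁] using a3.symm
  · refine hg₃ (hmono.apply_eq_zero hu hP ?_)
    have := hX.ae_eq_zero_of_apply_ne_zero hq hq2 hP hgy (v := (g f₁)⁻¹ • f₁) (by simp [hg₁]) (by
      filter_upwards [hd12, hyae, coe_smul_ae (g f₁)⁻¹ f₁] with ω a1 a2 a3
      rw [a2, a3]
      rcases a1 with a1 | a1
      · rw [a1, mul_zero, abs_zero]
        exact abs_nonneg _
      · simp [a1])
    filter_upwards [this, hd] with ω a1 a2
    exact a2.symm.imp_right a1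

/-! ### Separability and order continuity -/

theorem restr_congr {S T : Set Ω} (hS : MeasurableSet S) (hT : MeasurableSet T) (h : S = T)
    (f : X.carrier) : restr hS f = restr hT f := by
  subst h
  rfl

theorem restr_empty (f : X.carrier) : restr MeasurableSet.empty f = 0 := by
  refine ext_ae ?_
  filter_upwards [coe_restr_ae MeasurableSet.empty f, coe_zero_ae (X := X)] with ω h1 h2
  rw [h1, h2, Set.indicator_empty]

theorem restr_sub_restr {S T : Set Ω} (hS : MeasurableSet S) (hT : MeasurableSet T) (h : T ⊆ S)
    (f : X.carrier) : restr hS f - restr hT f = restr (hS.diff hT) f := by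
  rw [sub_eq_iff_eq_add, restr_add (hS.diff hT) hT Set.disjoint_sdiff_left]
  exact restr_congr _ _ (Set.sdiff_union_of_subset h).symm f

/-- The elements of a separable function space have no sequence of disjoint pieces of norm bounded
away from zero. -/
theorem exists_norm_restr_lt [TopologicalSpace.SeparableSpace X.carrier] (f : X.carrier)
    {D : ℕ → Set Ω} (hD : ∀ n, MeasurableSet (D n)) (hd : Pairwise (Function.onFun Disjoint D))
    {ε : ℝ} (hε : 0 < ε) : ∃ n, ‖restr (hD n) f‖ < ε := by
  by_contra! H
  -- Truncating `f` to the unions over all `K ⊆ ℕ` gives elements pairwise at distance at least `ε`.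
  -- Their balls of radius `ε / 2` are disjoint, so separability would make `Set ℕ` countable.
  have hU : ∀ K : Set ℕ, MeasurableSet (⋃ k ∈ K, D k) := fun K =>
    MeasurableSet.biUnion K.to_countable fun k _ => hD k
  have hint : ∀ (K : Set ℕ) (k : ℕ), k ∈ K → D k ∩ ⋃ j ∈ K, D j = D k := fun K k hk =>
    Set.inter_eq_left.2 (Set.subset_biUnion_of_mem (u := D) hk)
  have hint' : ∀ (K : Set ℕ) (k : ℕ), k ∉ K → D k ∩ ⋃ j ∈ K, D j = ∅ := fun K k hk => by
    rw [← Set.disjoint_iff_inter_eq_empty, Set.disjoint_iUnion₂_right]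
    exact fun j hj => hd fun h => hk (h ▸ hj)
  have h1 : ∀ (K K' : Set ℕ) (k : ℕ), k ∈ K → k ∉ K' →
      ε ≤ ‖restr (hU K) f - restr (hU K') f‖ := fun K K' k hk hk' => by
    refine (H k).trans ?_
    have h2 := norm_restr_le (hD k) (restr (hU K) f - restr (hU K') f)
    rwa [restr_sub, restr_restr, restr_restr, restr_congr _ (hD k) (hint K k hk),
      restr_congr _ MeasurableSet.empty (hint' K' k hk'), restr_empty, sub_zero] at h2
  have h2 : ∀ K K' : Set ℕ, K ≠ K' → ε ≤ dist (restr (hU K) f) (restr (hU K') f) := by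
    intro K K' hne
    rw [dist_eq_norm]
    by_cases hs : K ⊆ K'
    · obtain ⟨k, hk, hk'⟩ := Set.not_subset.1 fun h => hne (hs.antisymm h)
      rw [norm_sub_rev]
      exact h1 K' K k hk hk'
    · obtain ⟨k, hk, hk'⟩ := Set.not_subset.1 hs
      exact h1 K K' k hk hk'
  have h3 : (Set.univ : Set (Set ℕ)).Countable := by
    refine Set.PairwiseDisjoint.countable_of_isOpen
      (s := fun K => Metric.ball (restr (hU K) f) (ε / 2)) ?_ (fun K _ => Metric.isOpen_ball)
      fun K _ => ⟨_, Metric.mem_ball_self (half_pos hε)⟩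
    intro K _ K' _ hne
    exact Metric.ball_disjoint_ball (by linarith [h2 K K' hne])
  have : Countable (Set ℕ) := Set.countable_univ_iff.1 h3
  obtain ⟨F, hF⟩ := exists_injective_nat (Set ℕ)
  exact Function.cantor_injective F hF

/-- A separable Banach function space is order continuous. -/
theorem tendsto_restr_of_antitone [CompleteSpace X.carrier]
    [TopologicalSpace.SeparableSpace X.carrier] (f : X.carrier) {B : ℕ → Set Ω}
    (hB : ∀ n, MeasurableSet (B n)) (hanti : Antitone B) (hempty : ⋂ n, B n = ∅) :
    Tendsto (fun n => restr (hB n) f) atTop (nhds 0) := by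
  have hc : CauchySeq fun n => restr (hB n) f := by
    -- If the Cauchy property fails, iterating the choice of a bad later index yields disjoint
    -- differences `B (s k) \ B (s (k + 1))` on which `f` has norm at least `ε`.
    rw [Metric.cauchySeq_iff']
    by_contra! H
    obtain ⟨ε, hε, H⟩ := H
    choose ν hν hν' using H
    have hlt : ∀ n, n < ν n := fun n => lt_of_le_of_ne (hν n) fun h => by
      have := hν' n
      rw [← h, dist_self] at this
      linarith
    set s : ℕ → ℕ := fun k => ν^[k] 0 with hs
    have hs1 : ∀ k, s (k + 1) = ν (s k) := fun k => Function.iterate_succ_apply' ν k 0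
    have hsm : StrictMono s := strictMono_nat_of_lt_succ fun k => by rw [hs1]; exact hlt _
    obtain ⟨k, hk⟩ := exists_norm_restr_lt f (D := fun k => B (s k) \ B (s (k + 1)))
      (fun k => (hB _).diff (hB _)) (by
        refine (pairwise_disjoint_on _).2 fun i j hij => ?_
        refine Set.disjoint_left.2 fun ω h1 h2 => h1.2 ?_
        exact hanti (hsm.monotone hij) h2.1) hε
    refine absurd hk (not_lt.2 ?_)
    rw [← restr_sub_restr (hB _) (hB _) (hanti (hsm.monotone k.le_succ)), ← dist_eq_norm, dist_comm]
    have := hν' (s k)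
    rwa [← restr_congr (hB (s (k + 1))) (hB (ν (s k))) (by rw [hs1])] at this
  obtain ⟨e, he⟩ := cauchySeq_tendsto_of_complete hc
  suffices e = 0 by rwa [this] at he
  -- For `n ≥ m` the truncation to `B n` vanishes off `B m`; this passes to the limit `e`.
  have h1 : ∀ m, restr (hB m).compl e = 0 := fun m => by
    have h2 : ∀ n, m ≤ n → ‖restr (hB m).compl e‖ ≤ ‖e - restr (hB n) f‖ := fun n hn => by
      have h3 := norm_restr_le (hB m).compl (e - restr (hB n) f)
      have h4 : (B m)ᶜ ∩ B n = ∅ := by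
        rw [← Set.disjoint_iff_inter_eq_empty, Set.disjoint_compl_left_iff_subset]
        exact hanti hn
      rwa [restr_sub, restr_restr, restr_congr _ MeasurableSet.empty h4, restr_empty,
        sub_zero] at h3
    have h4 : Tendsto (fun n => ‖e - restr (hB n) f‖) atTop (nhds 0) := by
      have := (tendsto_const_nhds (x := e)).sub he
      rw [sub_self] at this
      simpa using this.norm
    have h5 := ge_of_tendsto h4 (eventually_atTop.2 ⟨m, h2⟩)
    exact norm_le_zero_iff.1 h5
  refine ext_ae ?_
  filter_upwards [ae_all_iff.2 fun m => coe_restr_ae (hB m).compl e, coe_zero_ae (X := X)]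
    with ω h2 h3
  have h4 : ω ∉ ⋂ n, B n := by simp [hempty]
  obtain ⟨m, hm⟩ : ∃ m, ω ∉ B m := by simpa using h4
  have h5 := h2 m
  rw [h1 m, Set.indicator_of_mem (by exact hm)] at h5
  exact h5.symm

/-! ### From indecomposable charged sets to atoms -/

theorem Charged.mono {g : X.carrier →L[ℝ] ℝ} {S T : Set Ω} (h : Charged g S) (hST : S ⊆ T) :
    Charged g T := by
  obtain ⟨f, hf, hgf⟩ := h
  exact ⟨f, hf.mono fun ω h hω => h fun h' => hω (hST h'), hgf⟩

theorem Charged.measure_ne_zero {g : X.carrier →L[ℝ] ℝ} {S : Set Ω} (h : Charged g S) :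
    μ S ≠ 0 := by
  obtain ⟨f, hf, hgf⟩ := h
  intro h0
  refine hgf ?_
  have : f = 0 := by
    refine ext_ae ?_
    filter_upwards [hf, measure_eq_zero_iff_ae_notMem.1 h0, coe_zero_ae (X := X)] with ω h1 h2 h3
    rw [h1 h2, h3]
  rw [this, map_zero]

theorem charged_of_apply_restr_ne_zero {g : X.carrier →L[ℝ] ℝ} {S : Set Ω} (hS : MeasurableSet S)
    {f : X.carrier} (h : g (restr hS f) ≠ 0) : Charged g S :=
  ⟨_, restr_ae_eq_zero hS f, h⟩

theorem exists_ae_eq_const_of_isMeasureAtom {A : Set Ω} (hA : IsMeasureAtom μ A)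
    {f : Ω → ℝ} (hf : Measurable f) : ∃ c : ℝ, ∀ᵐ ω ∂μ, ω ∈ A → f ω = c := by
  obtain ⟨c, hc⟩ := exists_eventuallyEq_const_of_forall_separating (l := ae (μ.restrict A))
    (f := f) MeasurableSet fun U hU => by
      have h := hA.2.2 (A ∩ f ⁻¹' U) Set.inter_subset_left (hA.1.inter (hf hU))
      rw [ae_restrict_iff' hA.1, ae_restrict_iff' hA.1]
      rcases h with h | h
      · right
        filter_upwards [measure_eq_zero_iff_ae_notMem.1 h] with ω h1 h2 h3
        exact h1 ⟨h2, h3⟩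
      · left
        filter_upwards [measure_eq_zero_iff_ae_notMem.1 h] with ω h1 h2
        by_contra h3
        exact h1 ⟨h2, fun h4 => h3 h4.2⟩
  exact ⟨c, (ae_restrict_iff' hA.1).1 hc⟩

/-- If `g` charges `S` but no two disjoint parts of `S`, then on `S` it is a multiple of the
integral over an atom. -/
theorem exists_isMeasureAtom_of_charged [SigmaFinite μ] [CompleteSpace X.carrier]
    [TopologicalSpace.SeparableSpace X.carrier] {g : X.carrier →L[ℝ] ℝ} {S : Set Ω}
    (hS : MeasurableSet S) (hch : Charged g S)
    (hind : ∀ B ⊆ S, MeasurableSet B → Charged g B → ¬ Charged g (S \ B)) :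
    ∃ (α : ℝ) (A : Set Ω), IsMeasureAtom μ A ∧ μ A < ∞ ∧
      ∀ f : X.carrier, g (restr hS f) = α * ∫ ω in A, f.1 ω ∂μ := by
  obtain ⟨f, hf, hgf⟩ := id hch
  have hsplit : ∀ {B C : Set Ω} (hB : MeasurableSet B) (hC : MeasurableSet C), C ⊆ B →
      ∀ h : X.carrier, g (restr hB h) = g (restr hC h) + g (restr (hB.diff hC) h) :=
    fun hB hC hCB h => by rw [← restr_sub_restr hB hC hCB, map_sub, add_sub_cancel]
  have hnull : ∀ {B : Set Ω} (hB : MeasurableSet B), ¬ Charged g B →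
      ∀ h : X.carrier, g (restr hB h) = 0 := fun hB hn h => by
    by_contra h0
    exact hn (charged_of_apply_restr_ne_zero hB h0)
  -- The complement in `S` of a charged set is uncharged, so truncating the fixed `f` to any charged
  -- `B ⊆ S` keeps the value `g f`. Thus `f` alone detects charge.
  have hval : ∀ {B : Set Ω} (hB : MeasurableSet B), B ⊆ S → Charged g B →
      g (restr hB f) = g f := fun hB hBS hBc => by
    have h1 := hsplit hS hB hBS f
    rw [restr_eq_self hS hf, hnull (hS.diff hB) (hind _ hBS hB hBc), add_zero] at h1
    exact h1.symm
  have hcompl : ∀ {B : Set Ω}, MeasurableSet B → B ⊆ S → ¬ Charged g B → Charged g (S \ B) :=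
    fun hB hBS hBc => by
      refine charged_of_apply_restr_ne_zero (hS.diff hB) (f := f) ?_
      have h1 := hsplit hS hB hBS f
      rw [hnull hB hBc, zero_add, restr_eq_self hS hf] at h1
      rwa [← h1]
  have hinter : ∀ {B C : Set Ω}, MeasurableSet B → MeasurableSet C → B ⊆ S → C ⊆ S →
      Charged g B → Charged g C → Charged g (B ∩ C) := fun {B C} hB hC hBS hCS hBc hCc => by
    by_contra hn
    have h1 := hsplit hB (hB.inter hC) Set.inter_subset_left f
    rw [hnull _ hn, zero_add, hval hB hBS hBc] at h1
    refine hind C hCS hC hCc (Charged.mono (charged_of_apply_restr_ne_zero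
      (hB.diff (hB.inter hC)) (h1 ▸ hgf)) ?_)
    exact fun ω hω => ⟨hBS hω.1, fun h => hω.2 ⟨hω.1, h⟩⟩
  -- Order continuity applied to `A n \ ⋂ m, A m`: the constant `g f - g (restr hI f)` tends to `0`.
  have hiInter : ∀ A : ℕ → Set Ω, (∀ n, MeasurableSet (A n)) → Antitone A → (∀ n, A n ⊆ S) →
      (∀ n, Charged g (A n)) → Charged g (⋂ n, A n) := fun A hA hanti hAS hAc => by
    have hI : MeasurableSet (⋂ n, A n) := MeasurableSet.iInter hA
    refine charged_of_apply_restr_ne_zero hI (f := f) ?_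
    have h1 := tendsto_restr_of_antitone f (B := fun n => A n \ ⋂ m, A m)
      (fun n => (hA n).diff hI) (fun i j hij => Set.sdiff_subset_sdiff_left (hanti hij)) (by
        refine Set.eq_empty_of_forall_notMem fun ω hω => ?_
        rw [Set.mem_iInter] at hω
        exact (hω 0).2 (Set.mem_iInter.2 fun n => (hω n).1))
    have h2 := (g.continuous.tendsto 0).comp h1
    rw [map_zero] at h2
    have h3 : ∀ n, g (restr ((hA n).diff hI) f) = g f - g (restr hI f) := fun n => by
      have := hsplit (hA n) hI (Set.iInter_subset A n) f
      rw [hval (hA n) (hAS n) (hAc n)] at this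
      linarith
    have h4 : g f - g (restr hI f) = 0 :=
      tendsto_nhds_unique (tendsto_const_nhds.congr fun n => (h3 n).symm) h2
    rw [← sub_eq_zero.1 h4]
    exact hgf
  -- Otherwise the complements of these sets in `S` would be charged and decrease to the empty set.
  obtain ⟨n, hn⟩ : ∃ n, Charged g (S ∩ spanningSets μ n) := by
    by_contra! hn
    have h1 := hiInter (fun n => S \ (S ∩ spanningSets μ n))
      (fun n => hS.diff (hS.inter (measurableSet_spanningSets μ n)))
      (fun i j hij => Set.sdiff_subset_sdiff_right
        (Set.inter_subset_inter_right S (monotone_spanningSets μ hij)))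
      (fun n => Set.sdiff_subset)
      (fun n => hcompl (hS.inter (measurableSet_spanningSets μ n)) Set.inter_subset_left (hn n))
    refine h1.measure_ne_zero ?_
    rw [← Set.sdiff_iUnion, ← Set.inter_iUnion, iUnion_spanningSets, Set.inter_univ, Set.sdiff_self,
      measure_empty]
  -- The infimum of the measures of charged subsets of `S` is attained, by intersecting a minimising
  -- sequence.
  set V : Set ℝ≥0∞ := μ '' {B | MeasurableSet B ∧ B ⊆ S ∧ Charged g B} with hV
  have hnV : μ (S ∩ spanningSets μ n) ∈ V :=
    ⟨_, ⟨hS.inter (measurableSet_spanningSets μ n), Set.inter_subset_left, hn⟩, rfl⟩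
  obtain ⟨v, -, hv, hvV⟩ := exists_seq_tendsto_sInf ⟨_, hnV⟩ (OrderBot.bddBelow V)
  choose B hB hBv using hvV
  obtain ⟨A, hAm, hAS, hAc, hAB⟩ : ∃ A, MeasurableSet A ∧ A ⊆ S ∧ Charged g A ∧ ∀ n, A ⊆ B n := by
    have hd : ∀ n, MeasurableSet (Set.dissipate B n) ∧ Set.dissipate B n ⊆ S ∧
        Charged g (Set.dissipate B n) := fun n => by
      induction n with
      | zero => simpa using hB 0
      | succ n ih =>
        rw [Set.dissipate_succ]
        exact ⟨ih.1.inter (hB (n + 1)).1, Set.inter_subset_left.trans ih.2.1,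
          hinter ih.1 (hB _).1 ih.2.1 (hB _).2.1 ih.2.2 (hB _).2.2⟩
    exact ⟨⋂ n, Set.dissipate B n, MeasurableSet.iInter fun n => (hd n).1,
      (Set.iInter_subset _ 0).trans (hd 0).2.1,
      hiInter _ (fun n => (hd n).1) Set.antitone_dissipate (fun n => (hd n).2.1)
        fun n => (hd n).2.2,
      fun n => (Set.iInter_subset _ n).trans (Set.dissipate_subset le_rfl)⟩
  have hmin : ∀ C, MeasurableSet C → C ⊆ S → Charged g C → μ A ≤ μ C := fun C hC hCS hCc =>
    (ge_of_tendsto' hv fun n => (measure_mono (hAB n)).trans (hBv n).le).trans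
      (sInf_le ⟨C, ⟨hC, hCS, hCc⟩, rfl⟩)
  have hAfin : μ A < ∞ := (hmin _ (hS.inter (measurableSet_spanningSets μ n))
    Set.inter_subset_left hn).trans_lt
      ((measure_mono Set.inter_subset_right).trans_lt (measure_spanningSets_lt_top μ n))
  have hzero : ∀ C ⊆ A, MeasurableSet C → Charged g C → μ (A \ C) = 0 := fun C hCA hC hCc => by
    rw [measure_sdiff hCA hC.nullMeasurableSet ((measure_mono hCA).trans_lt hAfin).ne]
    exact tsub_eq_zero_of_le (hmin C hC (hCA.trans hAS) hCc)
  -- For `C ⊆ A`, either `C` or `A \ C` is charged; by minimality of `A` the other one is null.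
  have hatom : IsMeasureAtom μ A := by
    refine ⟨hAm, pos_iff_ne_zero.2 hAc.measure_ne_zero, fun C hCA hC => ?_⟩
    by_cases hCc : Charged g C
    · exact Or.inr (hzero C hCA hC hCc)
    · left
      have h1 := hinter hAm (hS.diff hC) hAS Set.sdiff_subset hAc
        (hcompl hC (hCA.trans hAS) hCc)
      have h2 := hzero _ Set.inter_subset_left (hAm.inter (hS.diff hC)) h1
      refine measure_mono_null (fun ω hω => ?_) h2
      exact ⟨hCA hω, fun h => h.2.2 hω⟩
  have hA0 : μ.real A ≠ 0 := (ENNReal.toReal_pos hatom.2.1.ne' hAfin.ne).ne'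
  have hmk := AEEqFun.coeFn_mk (A.indicator fun _ => (1 : ℝ))
    ((stronglyMeasurable_const.indicator hAm).aestronglyMeasurable (μ := μ))
  set χ : X.carrier := ⟨_, X.indicator_mem A hAm hAfin _ hmk⟩ with hχ
  have hχae : ∀ᵐ ω ∂μ, χ.1 ω = A.indicator (fun _ => (1 : ℝ)) ω := hmk
  refine ⟨g χ / μ.real A, A, hatom, hAfin, fun h => ?_⟩
  obtain ⟨c, hc⟩ := exists_ae_eq_const_of_isMeasureAtom hatom h.1.stronglyMeasurable.measurable
  have h1 : restr hAm h = c • χ := by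
    refine ext_ae ?_
    filter_upwards [coe_restr_ae hAm h, coe_smul_ae c χ, hχae, hc] with ω a1 a2 a3 a4
    rw [a1, a2, a3]
    by_cases hω : ω ∈ A
    · simp [hω, a4 hω]
    · simp [hω]
  have h2 : ∫ ω in A, h.1 ω ∂μ = μ.real A * c := by
    rw [setIntegral_congr_ae hAm hc, setIntegral_const, smul_eq_mul]
  rw [hsplit hS hAm hAS, hnull (hS.diff hAm) (hind A hAS hAm hAc), add_zero, h1, h2, map_smul,
    smul_eq_mul]
  field_simp

/-! ### Assembling the representation of `g` -/

theorem integral_indicator_add_indicator_mul (f : X.carrier) {A B : Set Ω} (hA : MeasurableSet A)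
    (hB : MeasurableSet B) (hA' : μ A < ∞) (hB' : μ B < ∞) (α β : ℝ) :
    ∫ ω, (α * A.indicator (fun _ => (1 : ℝ)) ω + β * B.indicator (fun _ => (1 : ℝ)) ω) *
      f.1 ω ∂μ = α * ∫ ω in A, f.1 ω ∂μ + β * ∫ ω in B, f.1 ω ∂μ := by
  have h1 : ∀ ω, (α * A.indicator (fun _ => (1 : ℝ)) ω + β * B.indicator (fun _ => (1 : ℝ)) ω) *
      f.1 ω = α * A.indicator (fun ω => f.1 ω) ω + β * B.indicator (fun ω => f.1 ω) ω := fun ω => by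
    by_cases hωA : ω ∈ A <;> by_cases hωB : ω ∈ B <;> simp [hωA, hωB, add_mul]
  have hiA := (X.integrableOn _ f.2 A hA hA').integrable_indicator hA
  have hiB := (X.integrableOn _ f.2 B hB hB').integrable_indicator hB
  simp_rw [h1]
  rw [integral_add (hiA.const_mul α) (hiB.const_mul β), integral_const_mul, integral_const_mul,
    integral_indicator hA, integral_indicator hB]

end FunctionSpace

open FunctionSpace in
theorem mainTheorem5 {Ω : Type*} [MeasurableSpace Ω] (μ : Measure Ω) [SigmaFinite μ]
    (X : FunctionSpace μ) [CompleteSpace X.carrier] [TopologicalSpace.SeparableSpace X.carrier]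
    (hmono : X.StrictlyMonotone)
    (hX : (∃ p : ℝ, 2 < p ∧ X.OneConvex p) ∨
      ((∃ q : ℝ, 1 < q ∧ q < 2 ∧ X.OneConcave q) ∧
        ∀ A : Set Ω, IsMeasureAtom μ A → ∀ f : X.carrier,
          (f : Ω →ₘ[μ] ℝ) =ᵐ[μ] A.indicator (fun _ => (1 : ℝ)) → IsSmoothPoint f))
    (g : X.carrier →L[ℝ] ℝ) (hg : g ≠ 0) (hker : IsOneComplemented g.ker) :
    ∃ (α β : ℝ) (A B : Set Ω), IsMeasureAtom μ A ∧ IsMeasureAtom μ B ∧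
      ∀ f : X.carrier, g f = ∫ ω, (α * A.indicator (fun _ => (1 : ℝ)) ω +
        β * B.indicator (fun _ => (1 : ℝ)) ω) * (f : Ω →ₘ[μ] ℝ) ω ∂μ := by
  have h3 : ∀ {S₁ S₂ S₃ : Set Ω}, Disjoint S₁ S₂ → Disjoint S₁ S₃ → Disjoint S₂ S₃ →
      Charged g S₁ → Charged g S₂ → Charged g S₃ → False :=
    not_three_charged hmono (hX.imp_right And.left) hg hker
  -- Either no set and its complement are both charged, which gives a single atom, or some `S` and
  -- `Sᶜ` are both charged. In the latter case neither splits further, since that would produce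
  -- three disjoint charged sets.
  by_cases hind : ∀ B ⊆ Set.univ, MeasurableSet B → Charged g B → ¬ Charged g (Set.univ \ B)
  · obtain ⟨f₀, hf₀⟩ : ∃ f, g f ≠ 0 := by
      by_contra! H
      exact hg (ContinuousLinearMap.ext H)
    obtain ⟨α, A, hA, hA', h⟩ := exists_isMeasureAtom_of_charged MeasurableSet.univ
      ⟨f₀, Eventually.of_forall fun ω hω => absurd (Set.mem_univ ω) hω, hf₀⟩ hind
    refine ⟨α, 0, A, A, hA, hA, fun f => ?_⟩
    rw [integral_indicator_add_indicator_mul f hA.1 hA.1 hA' hA', zero_mul, add_zero, ← h,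
      restr_eq_self _ (Eventually.of_forall fun ω hω => absurd (Set.mem_univ ω) hω)]
  · push Not at hind
    obtain ⟨S, -, hS, hSc, hSc'⟩ := hind
    rw [← Set.compl_eq_univ_sdiff] at hSc'
    obtain ⟨α, A, hA, hA', h⟩ := exists_isMeasureAtom_of_charged hS hSc fun B hB _ hBc hBc' =>
      h3 Set.disjoint_sdiff_right (Set.disjoint_compl_right_iff_subset.2 hB)
        (Set.disjoint_compl_right_iff_subset.2 Set.sdiff_subset) hBc hBc' hSc'
    obtain ⟨β, B, hB, hB', h'⟩ := exists_isMeasureAtom_of_charged hS.compl hSc'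
      fun B hB _ hBc hBc' => h3 Set.disjoint_sdiff_right
        (Set.disjoint_left.2 fun _ h1 => hB h1) (Set.disjoint_left.2 fun _ h1 => h1.1) hBc hBc' hSc
    refine ⟨α, β, A, B, hA, hB, fun f => ?_⟩
    rw [integral_indicator_add_indicator_mul f hA.1 hB.1 hA' hB', ← h, ← h', ← map_add,
      restr_add_compl]
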